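/- Let $G$ be a compact (Hausdorff) topological group. For a closed subgroup $H\le G$ let $Pr(H,G)$ denote the probability that a random element of $H$ commutes with a random element of $G$, that is, the measure of the closed set $\{(h,g)\in H\times G : hg=gh\}$ with respect to the normalized Haar measure of the compact group $H\times G$ (the product of the normalized Haar measures of $H$ and $G$). For $x\in G$ let $\langle x\rangle$ denote the monothetic subgroup generated by $x$, i.e. the closure of the abstract cyclic subgroup generated by $x$. (1) Let $K$ be a closed subgroup of $G$. Then $Pr(\langle x\rangle,G)>0$ for every $x\in K$ if and only if $G$ has an open normal subgroup $T$ such that $K/C_K(T)$ is torsion, i.e. every element of $K/C_K(T)$ has finite order. (2) In particular, $Pr(\langle x\rangle,G)>0$ for every $x\in G$ if and only if $G$ is virtually central-by-torsion, that is, $G$ has an open normal subgroup $T$ such that $G/Z(T)$ is torsion. -/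

import Mathlib

open MeasureTheory TopologicalSpace
open scoped ENNReal

namespace CompactGroupPr

/-- The normalized Haar measure of a compact group, on its Borel `σ`-algebra. -/
noncomputable def normalizedHaar (G : Type*) [Group G] [TopologicalSpace G]
    [IsTopologicalGroup G] [CompactSpace G] : @Measure G (borel G) :=
  letI : MeasurableSpace G := borel G
  haveI : BorelSpace G := ⟨rfl⟩
  Measure.haarMeasure (⊤ : PositiveCompacts G)

variable {G : Type*} [Group G] [TopologicalSpace G]

/-- `Pr(H, G)`: the probability that a random element of the compact subgroup `H` commutes with a
random element of `G`. The commuting pairs form a closed subset of the compact group `H × G`, and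
the probability is its measure under the normalized Haar measure of `H × G`, i.e. the (Radon)
product of the normalized Haar measures of `H` and `G`. Taking the Haar measure on the Borel sets of
`H × G` makes this set measurable also when `G` is not second countable. -/
noncomputable def commutingPr [IsTopologicalGroup G] [CompactSpace G] (H : Subgroup G)
    [CompactSpace H] : ℝ≥0∞ :=
  normalizedHaar (H × G) {p : H × G | (p.1 : G) * p.2 = p.2 * (p.1 : G)}

/-- The monothetic subgroup of `G` topologically generated by `x`. -/
def monothetic [IsTopologicalGroup G] (x : G) : Subgroup G :=
  (Subgroup.zpowers x).topologicalClosure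

instance [IsTopologicalGroup G] [CompactSpace G] (x : G) : CompactSpace (monothetic x) :=
  isCompact_iff_compactSpace.mp
    (Subgroup.isClosed_topologicalClosure (Subgroup.zpowers x)).isCompact

/-- `C_K(T)`, as a subgroup of `K`. -/
def centralizerIn (K T : Subgroup G) : Subgroup K :=
  (Subgroup.centralizer (T : Set G)).subgroupOf K

instance (K T : Subgroup G) [T.Normal] : (centralizerIn K T).Normal := by
  unfold centralizerIn; infer_instance

/-- `Z(T)`, as a subgroup of `G`. -/
def centerOf (T : Subgroup G) : Subgroup G :=
  (Subgroup.center T).map T.subtype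

instance (T : Subgroup G) [T.Normal] : (centerOf T).Normal := by
  unfold centerOf; infer_instance

/-- `G` is virtually central-by-torsion: `G / Z(T)` is torsion for some open normal `T`. -/
def IsVirtuallyCentralByTorsion (G : Type*) [Group G] [TopologicalSpace G] : Prop :=
  ∃ (T : Subgroup G) (_ : T.Normal), IsOpen (T : Set G) ∧ IsMulTorsion (G ⧸ centerOf T)

end CompactGroupPr

namespace CompactGroupPr

open Filter Topology Pointwise

/-! Positivity of `Pr(⟨x⟩, G)` means that some positive power of `x` has open centralizer
(`exists_isOpen_centralizer_pow`, `commutingPr_monothetic_pos`). The hard point is to find one `T`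
that serves all of `K`.

If there is none, induction yields commuting `y i ∈ K` and decreasing open subgroups `T i`
centralizing `y i`, with `T i` not inside `powCentralizer (y j)` for `i < j`. The closure `A` of the
subgroup generated by the `y i` is abelian. By Baire (`exists_powCentralizer_le`) a finite-index
subgroup lies in every `powCentralizer c`, `c ∈ A`. Only finitely many subgroups lie above it, so
the intersections of the first `powCentralizer (y l)` stabilize and force some `T i ≤ powCentralizer
(y j)` with `i < j`. -/

/-! ### Positive probability and open centralizers of powers -/

/-- A closed subgroup of positive Haar measure in a compact group is open. -/
theorem isOpen_of_normalizedHaar_pos {G : Type*} [Group G] [TopologicalSpace G]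
    [IsTopologicalGroup G] [CompactSpace G] (S : Subgroup G) (hc : IsClosed (S : Set G))
    (h : 0 < normalizedHaar G S) : IsOpen (S : Set G) := by
  let : MeasurableSpace G := borel G
  have : BorelSpace G := ⟨rfl⟩
  have h' : 0 < Measure.haarMeasure (⊤ : PositiveCompacts G) (S : Set G) := h
  have := Measure.div_mem_nhds_one_of_haar_pos _ _ hc.measurableSet h'
  refine S.isOpen_of_mem_nhds (g := 1) (mem_of_superset this ?_)
  rintro _ ⟨a, ha, b, hb, rfl⟩
  exact S.div_mem ha hb

theorem exists_pow_mem_nhds_one {G : Type*} [Group G] [TopologicalSpace G]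
    [IsTopologicalGroup G] [CompactSpace G] (x : G) {V : Set G} (hV : V ∈ 𝓝 (1 : G)) (N : ℕ) :
    ∃ n, N < n ∧ x ^ n ∈ V := by
  have h := (mapClusterPt_iff_frequently.mp (mapClusterPt_one_atTop_pow x)) V hV
  obtain ⟨n, hn, hx⟩ := frequently_atTop.mp h (N + 1)
  exact ⟨n, hn, hx⟩

variable {G : Type*} [Group G] [TopologicalSpace G] [IsTopologicalGroup G]

theorem isClosed_centralizer [T2Space G] (s : Set G) :
    IsClosed (Subgroup.centralizer s : Set G) := Set.isClosed_centralizer s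

/-- If `H` commutes with `G` with positive probability, then all elements of `H` close to `1`
have open centralizer in `G`. -/
theorem eventually_isOpen_centralizer [CompactSpace G] [T2Space G] (H : Subgroup G)
    [CompactSpace H] (hpos : 0 < commutingPr H) :
    ∀ᶠ h : H in 𝓝 1, IsOpen (Subgroup.centralizer {(h : G)} : Set G) := by
  let : MeasurableSpace (H × G) := borel (H × G)
  have : BorelSpace (H × G) := ⟨rfl⟩
  set μ : Measure (H × G) := Measure.haarMeasure (⊤ : PositiveCompacts (H × G)) with hμ
  set E : Set (H × G) := {p : H × G | (p.1 : G) * p.2 = p.2 * (p.1 : G)} with hE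
  have hEpos : 0 < μ E := hpos
  have hEc : IsClosed E := isClosed_eq (by fun_prop) (by fun_prop)
  have hev : ∀ᶠ g in 𝓝 (1 : H × G), μ (g • E \ E) < μ E :=
    eventually_nhds_one_measure_smul_sdiff_lt hEc.isCompact hEc hEpos.ne'
  have hcont : Tendsto (fun h : H => (h, (1 : G))) (𝓝 1) (𝓝 (1 : H × G)) :=
    Continuous.tendsto (by fun_prop : Continuous fun h : H => (h, (1 : G))) 1
  filter_upwards [hcont.eventually hev] with h hh
  set C := Subgroup.centralizer {(h : G)} with hC
  -- If `g` commutes with both `a` and `h * a`, it commutes with `h`.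
  have hsub : ((h, (1 : G)) • E) ∩ E ⊆ ((⊤ : Subgroup H).prod C : Set (H × G)) := by
    rintro _ ⟨⟨⟨a, g⟩, ha, rfl⟩, hb⟩
    have ha' : Commute (a : G) g := ha
    have hb' : Commute ((h : G) * a) (1 * g) := hb
    rw [one_mul] at hb'
    have : Commute (h : G) g := by simpa using hb'.mul_left ha'.inv_left
    simp only [SetLike.mem_coe, Subgroup.mem_prod, Subgroup.mem_top, true_and]
    simpa [hC, Subgroup.mem_centralizer_singleton_iff] using this.eq.symm
  have hprod : 0 < μ ((⊤ : Subgroup H).prod C : Set (H × G)) := by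
    refine lt_of_lt_of_le ?_ (measure_mono hsub)
    rw [pos_iff_ne_zero]
    intro h0
    have h1 : μ ((h, (1 : G)) • E) ≤ μ (((h, (1 : G)) • E) ∩ E) + μ ((h, (1 : G)) • E \ E) :=
      measure_le_inter_add_sdiff _ _ _
    rw [h0, zero_add, measure_smul] at h1
    exact absurd hh (not_lt.mpr h1)
  have hcl : IsClosed ((⊤ : Subgroup H).prod C : Set (H × G)) := by
    rw [Subgroup.coe_prod]
    exact isClosed_univ.prod (isClosed_centralizer _)
  have hop := isOpen_of_normalizedHaar_pos _ hcl hprod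
  have : (C : Set G) = (fun g : G => ((1 : H), g)) ⁻¹' ((⊤ : Subgroup H).prod C : Set (H × G)) := by
    ext g; simp [Subgroup.mem_prod]
  rw [this]
  exact hop.preimage (by fun_prop)

theorem exists_isOpen_centralizer_pow [CompactSpace G] [T2Space G] {x : G}
    (hpos : 0 < commutingPr (monothetic x)) :
    ∃ n, 0 < n ∧ IsOpen (Subgroup.centralizer {x ^ n} : Set G) := by
  have hx : x ∈ monothetic x :=
    Subgroup.le_topologicalClosure _ (Subgroup.mem_zpowers x)
  obtain ⟨n, hn, h⟩ := exists_pow_mem_nhds_one (⟨x, hx⟩ : monothetic x)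
    (eventually_isOpen_centralizer _ hpos) 0
  exact ⟨n, hn, by simpa using h⟩

/-- The double centralizer `P` of `x ^ n` is closed and contains `x ^ n`, so `n` translates of it
cover `⟨x⟩`. Hence `P ∩ ⟨x⟩` is open, and its product with `C` is an open box of commuting pairs. -/
theorem commutingPr_monothetic_pos [CompactSpace G] [T2Space G] {x : G} {n : ℕ} (hn : 0 < n)
    (ho : IsOpen (Subgroup.centralizer {x ^ n} : Set G)) :
    0 < commutingPr (monothetic x) := by
  let : MeasurableSpace (monothetic x × G) := borel (monothetic x × G)
  have : BorelSpace (monothetic x × G) := ⟨rfl⟩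
  set C := Subgroup.centralizer {x ^ n} with hC
  set P := Subgroup.centralizer (C : Set G) with hP
  have hxP : x ^ n ∈ P := by
    rw [hP, Subgroup.mem_centralizer_iff]
    intro g hg
    exact (Subgroup.mem_centralizer_singleton_iff.mp hg)
  have hPc : IsClosed (P : Set G) := isClosed_centralizer _
  have hcover : (monothetic x : Set G) ⊆ ⋃ i ∈ Finset.range n, x ^ i • (P : Set G) := by
    refine closure_minimal ?_ (isClosed_biUnion_finset fun i _ => hPc.smul _)
    rintro _ ⟨k, rfl⟩
    have hn' : (n : ℤ) ≠ 0 := by exact_mod_cast hn.ne'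
    obtain ⟨i, hi⟩ := Int.eq_ofNat_of_zero_le (Int.emod_nonneg k hn')
    have hlt := Int.emod_lt_of_pos k (by exact_mod_cast hn : (0 : ℤ) < n)
    refine Set.mem_biUnion (x := i) (by simp; omega) ?_
    refine ⟨(x ^ n) ^ (k / n), P.zpow_mem hxP _, ?_⟩
    change x ^ i * (x ^ n) ^ (k / n) = x ^ k
    rw [← zpow_natCast, ← zpow_natCast, ← zpow_mul, ← zpow_add]
    congr 1
    have := Int.emod_add_mul_ediv k n
    omega
  have hx : x ∈ monothetic x :=
    Subgroup.le_topologicalClosure _ (Subgroup.mem_zpowers x)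
  have hfin : (P.subgroupOf (monothetic x)).FiniteIndex := by
    have : Finite (monothetic x ⧸ P.subgroupOf (monothetic x)) := by
      refine Finite.of_surjective (fun i : Fin n =>
        (((⟨x, hx⟩ : monothetic x) ^ (i : ℕ) : monothetic x) :
          monothetic x ⧸ P.subgroupOf (monothetic x))) ?_
      intro q
      obtain ⟨h, rfl⟩ := QuotientGroup.mk_surjective q
      obtain ⟨i, hi, p, hp, hip⟩ := Set.mem_iUnion₂.mp (hcover h.2)
      refine ⟨⟨i, Finset.mem_range.mp hi⟩, ?_⟩
      rw [QuotientGroup.eq, Subgroup.mem_subgroupOf]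
      have : x ^ i * p = h := hip
      simpa [← this] using hp
    exact Subgroup.finiteIndex_of_finite_quotient
  have hPo : IsOpen (P.subgroupOf (monothetic x) : Set (monothetic x)) :=
    Subgroup.isOpen_of_isClosed_of_finiteIndex _ (hPc.preimage continuous_subtype_val)
  have hbox : 0 < Measure.haarMeasure (⊤ : PositiveCompacts (monothetic x × G))
      ((P.subgroupOf (monothetic x) : Set (monothetic x)) ×ˢ (C : Set G)) :=
    (hPo.prod ho).measure_pos _ ⟨(1, 1), one_mem _, one_mem _⟩
  refine lt_of_lt_of_le hbox (measure_mono ?_)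
  rintro ⟨h, g⟩ ⟨hh, hg⟩
  exact (Subgroup.mem_centralizer_iff.mp (Subgroup.mem_subgroupOf.mp hh) g hg).symm

end CompactGroupPr

namespace CompactGroupPr

open Filter Topology Pointwise

/-! ### Power centralizers and numbers of conjugates -/

/-- The elements of `G` that commute with some positive power of `y`. -/
def powCentralizer {G : Type*} [Group G] (y : G) : Subgroup G where
  carrier := {g | ∃ k, 0 < k ∧ Commute g (y ^ k)}
  one_mem' := ⟨1, one_pos, Commute.one_left _⟩
  mul_mem' := by
    rintro a b ⟨k, hk, ha⟩ ⟨l, hl, hb⟩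
    refine ⟨k * l, Nat.mul_pos hk hl, Commute.mul_left ?_ ?_⟩
    · rw [pow_mul]; exact ha.pow_right l
    · rw [mul_comm, pow_mul]; exact hb.pow_right k
  inv_mem' := by
    rintro a ⟨k, hk, ha⟩
    exact ⟨k, hk, ha.inv_left⟩

section Algebra

variable {G : Type*} [Group G]

theorem centralizer_pow_le_powCentralizer (y : G) {n : ℕ} (hn : 0 < n) :
    Subgroup.centralizer {y ^ n} ≤ powCentralizer y := fun _ hg =>
  ⟨n, hn, Subgroup.mem_centralizer_singleton_iff.mp hg⟩

theorem powCentralizer_pow_le (y : G) {n : ℕ} (hn : 0 < n) :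
    powCentralizer (y ^ n) ≤ powCentralizer y := by
  rintro g ⟨k, hk, hg⟩
  exact ⟨n * k, Nat.mul_pos hn hk, by rwa [pow_mul]⟩

theorem powCentralizer_inv_le (y : G) : powCentralizer y⁻¹ ≤ powCentralizer y := by
  rintro g ⟨k, hk, hg⟩
  exact ⟨k, hk, by simpa using hg.inv_right⟩

theorem powCentralizer_inf_le {a b : G} (hab : Commute a b) :
    powCentralizer a ⊓ powCentralizer b ≤ powCentralizer (a * b) := by
  rintro g ⟨⟨k, hk, ha⟩, ⟨l, hl, hb⟩⟩
  refine ⟨k * l, Nat.mul_pos hk hl, ?_⟩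
  rw [hab.mul_pow]
  refine Commute.mul_right ?_ ?_
  · rw [pow_mul]; exact ha.pow_right l
  · rw [mul_comm, pow_mul]; exact hb.pow_right k

theorem powCentralizer_le_pow (y : G) (n : ℕ) :
    powCentralizer y ≤ powCentralizer (y ^ n) := by
  rintro g ⟨k, hk, hg⟩
  exact ⟨k, hk, by rw [← pow_mul, mul_comm, pow_mul]; exact hg.pow_right n⟩

/-- Only finitely many subgroups contain a given subgroup of finite index. -/
theorem finite_setOf_le_of_finiteIndex (P : Subgroup G) [P.FiniteIndex] :
    {S : Subgroup G | P ≤ S}.Finite := by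
  have hinj : Set.InjOn (fun S : Subgroup G => ((QuotientGroup.mk : G → G ⧸ P) '' S))
      {S : Subgroup G | P ≤ S} := by
    have key : ∀ S T : Subgroup G, P ≤ T → ((QuotientGroup.mk : G → G ⧸ P) '' S) =
        ((QuotientGroup.mk : G → G ⧸ P) '' T) → S ≤ T := by
      intro S T hT h g hg
      have : (g : G ⧸ P) ∈ (QuotientGroup.mk : G → G ⧸ P) '' T := h ▸ ⟨g, hg, rfl⟩
      obtain ⟨t, ht, htg⟩ := this
      have := T.mul_mem ht (hT (QuotientGroup.eq.mp htg))
      simpa using this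
    intro S hS T hT h
    exact le_antisymm (key S T hT h) (key T S hS h.symm)
  exact Set.Finite.of_finite_image (Set.toFinite _) hinj

/-- `y` has at most `m` conjugates. -/
def HasFewConjugates (m : ℕ) (y : G) : Prop :=
  ∀ g : Fin (m + 1) → G, ∃ i j, i ≠ j ∧ g i * y * (g i)⁻¹ = g j * y * (g j)⁻¹

theorem mk_eq_mk_centralizer_iff {y a b : G} :
    (a : G ⧸ Subgroup.centralizer {y}) = b ↔ a * y * a⁻¹ = b * y * b⁻¹ := by
  rw [QuotientGroup.eq, Subgroup.mem_centralizer_singleton_iff]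
  constructor
  · intro h
    have h2 : a * (a⁻¹ * b * y) * b⁻¹ = a * (y * (a⁻¹ * b)) * b⁻¹ := by rw [h]
    simpa [mul_assoc] using h2.symm
  · intro h
    have h2 : a⁻¹ * (a * y * a⁻¹) * b = a⁻¹ * (b * y * b⁻¹) * b := by rw [h]
    simpa [mul_assoc] using h2.symm

theorem hasFewConjugates_index (y : G) [(Subgroup.centralizer {y}).FiniteIndex] :
    HasFewConjugates (Subgroup.centralizer {y}).index y := by
  intro g
  have := Fintype.ofFinite (G ⧸ Subgroup.centralizer {y})
  obtain ⟨i, j, hij, h⟩ := Fintype.exists_ne_map_eq_of_card_lt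
    (fun i => (g i : G ⧸ Subgroup.centralizer {y})) (by
      rw [← Nat.card_eq_fintype_card, ← Subgroup.index]; simp)
  exact ⟨i, j, hij, mk_eq_mk_centralizer_iff.mp h⟩

/-- Finiteness is asserted separately because an infinite index has the value `0`. -/
theorem HasFewConjugates.finiteIndex_and_index_le {m : ℕ} {y : G} (h : HasFewConjugates m y) :
    (Subgroup.centralizer {y}).FiniteIndex ∧ (Subgroup.centralizer {y}).index ≤ m := by
  have hno : ¬ Nonempty (Fin (m + 1) ↪ G ⧸ Subgroup.centralizer {y}) := by
    rintro ⟨f⟩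
    obtain ⟨i, j, hij, he⟩ := h fun i => (f i).out
    refine hij (f.injective ?_)
    simpa using mk_eq_mk_centralizer_iff.mpr he
  have hfin : Finite (G ⧸ Subgroup.centralizer {y}) := by
    by_contra hinf
    have := not_finite_iff_infinite.mp hinf
    exact hno ⟨Fin.valEmbedding.trans (Infinite.natEmbedding _)⟩
  refine ⟨Subgroup.finiteIndex_of_finite_quotient, ?_⟩
  by_contra! hlt
  have := Fintype.ofFinite (G ⧸ Subgroup.centralizer {y})
  refine hno (Function.Embedding.nonempty_of_card_le ?_)
  rw [Fintype.card_fin, ← Nat.card_eq_fintype_card]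
  exact hlt

end Algebra

/-! ### A Baire argument in closed abelian subgroups -/

variable {G : Type*} [Group G] [TopologicalSpace G] [IsTopologicalGroup G]

/-- The pigeonhole form of `HasFewConjugates` makes this an intersection of finite unions of
equalizers. -/
theorem isClosed_setOf_hasFewConjugates [T2Space G] (m : ℕ) :
    IsClosed {y : G | HasFewConjugates m y} := by
  simp only [HasFewConjugates, Set.ofPred_forall, Set.ofPred_exists]
  refine isClosed_iInter fun g => isClosed_iUnion_of_finite fun i =>
    isClosed_iUnion_of_finite fun j => ?_
  exact isClosed_const.and (isClosed_eq (by fun_prop) (by fun_prop))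

theorem finiteIndex_of_isOpen [CompactSpace G] {S : Subgroup G} (h : IsOpen (S : Set G)) :
    S.FiniteIndex := by
  have := S.quotient_finite_of_isOpen h
  exact Subgroup.finiteIndex_of_finite_quotient

/-- In a closed abelian subgroup `A` all of whose elements have a power with open centralizer in
`G`, some `u` has the smallest possible power centralizer, and this has finite index. -/
theorem exists_powCentralizer_le [CompactSpace G] [T2Space G] {A : Subgroup G}
    (hA : IsClosed (A : Set G)) (hcomm : ∀ a ∈ A, ∀ b ∈ A, Commute a b)
    (hpow : ∀ a ∈ A, ∃ n, 0 < n ∧ IsOpen (Subgroup.centralizer {a ^ n} : Set G)) :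
    ∃ u ∈ A, (powCentralizer u).FiniteIndex ∧
      ∀ c ∈ A, powCentralizer u ≤ powCentralizer c := by
  have : CompactSpace A := isCompact_iff_compactSpace.mp hA.isCompact
  have hfin : ∀ a ∈ A, (powCentralizer a).FiniteIndex := by
    intro a ha
    obtain ⟨n, hn, ho⟩ := hpow a ha
    have := finiteIndex_of_isOpen ho
    exact Subgroup.finiteIndex_of_le (centralizer_pow_le_powCentralizer a hn)
  obtain ⟨⟨n, m⟩, v, hv⟩ := nonempty_interior_of_iUnion_of_closed
    (f := fun p : ℕ × ℕ => {a : A | HasFewConjugates p.2 ((a : G) ^ (p.1 + 1))})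
    (fun p => (isClosed_setOf_hasFewConjugates p.2).preimage (by fun_prop))
    (by
      refine Set.eq_univ_of_forall fun a => ?_
      obtain ⟨n, hn, ho⟩ := hpow a a.2
      obtain ⟨n, rfl⟩ := Nat.exists_eq_succ_of_ne_zero hn.ne'
      have := finiteIndex_of_isOpen ho
      exact Set.mem_iUnion.mpr ⟨(n, (Subgroup.centralizer {(a : G) ^ (n + 1)}).index),
        hasFewConjugates_index ((a : G) ^ (n + 1))⟩)
  set U := interior {a : A | HasFewConjugates m ((a : G) ^ (n + 1))} with hU
  have hbound : ∀ a ∈ U, (powCentralizer (a : G)).index ≤ m := by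
    intro a ha
    obtain ⟨h1, h2⟩ := (interior_subset ha : HasFewConjugates m _).finiteIndex_and_index_le
    exact (Subgroup.index_antitone
      (centralizer_pow_le_powCentralizer (a : G) n.succ_pos)).trans h2
  -- Maximal index on `U` will rule out any `powCentralizer` of a point of `U` strictly inside that
  -- of `u`.
  obtain ⟨u, huU, hmax⟩ : ∃ u ∈ U, ∀ a ∈ U,
      (powCentralizer (a : G)).index ≤ (powCentralizer (u : G)).index := by
    have hs : ((fun a : A => (powCentralizer (a : G)).index) '' U).Finite :=
      (Set.finite_Iic m).subset (by rintro _ ⟨a, ha, rfl⟩; exact hbound a ha)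
    obtain ⟨_, ⟨⟨u, hu, rfl⟩, h⟩⟩ := hs.exists_maximal ⟨_, v, hv, rfl⟩
    refine ⟨u, hu, fun a ha => ?_⟩
    rcases le_total (powCentralizer (a : G)).index (powCentralizer (u : G)).index with h' | h'
    · exact h'
    · exact h ⟨a, ha, rfl⟩ h'
  refine ⟨u, u.2, hfin u u.2, fun c hc => ?_⟩
  have hV : (fun a : A => u * a) ⁻¹' U ∈ 𝓝 (1 : A) :=
    (isOpen_interior.preimage (by fun_prop)).mem_nhds (by simpa using huU)
  have hI : {i : ℕ | u * (⟨c, hc⟩ : A) ^ i ∈ U}.Infinite := by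
    refine Set.infinite_of_forall_exists_gt fun N => ?_
    obtain ⟨i, hi, h⟩ := exists_pow_mem_nhds_one (⟨c, hc⟩ : A) hV N
    exact ⟨i, h, hi⟩
  have huc : ∀ i, Commute (u : G) (c ^ i) := fun i => (hcomm u u.2 c hc).pow_right i
  have := hfin u u.2
  have := hfin c hc
  -- Two of the returning points `u * c ^ i` share a power centralizer `S`. Their quotient is a
  -- positive power of `c`, so `S` lies in that of `c`, and then in that of `u`.
  obtain ⟨i, hi, j, -, hij, he⟩ := hI.exists_lt_map_eq_of_mapsTo
    (f := fun i => powCentralizer ((u : G) * c ^ i))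
    (t := {S | powCentralizer (u : G) ⊓ powCentralizer c ≤ S})
    (fun i _ => (inf_le_inf_left _ (powCentralizer_le_pow c i)).trans
      (powCentralizer_inf_le (huc i)))
    (finite_setOf_le_of_finiteIndex _)
  set S := powCentralizer ((u : G) * c ^ i) with hS
  have hSc : S ≤ powCentralizer c := by
    have h1 : S ≤ powCentralizer (((u : G) * c ^ i)⁻¹) := by
      simpa using powCentralizer_inv_le (((u : G) * c ^ i)⁻¹)
    have hmul : ((u : G) * c ^ i)⁻¹ * (u * c ^ j) = c ^ (j - i) := by
      rw [← Nat.add_sub_cancel' hij.le, pow_add, Nat.add_sub_cancel_left]; group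
    have hc1 : Commute ((u : G) * c ^ i) (u * c ^ j) :=
      hcomm _ (A.mul_mem u.2 (A.pow_mem hc i)) _ (A.mul_mem u.2 (A.pow_mem hc j))
    have h2 := (le_inf h1 he.le).trans (powCentralizer_inf_le hc1.inv_left)
    rw [hmul] at h2
    exact h2.trans (powCentralizer_pow_le c (by omega))
  have hSu : S ≤ powCentralizer (u : G) := by
    have h1 : S ≤ powCentralizer ((c ^ i)⁻¹) :=
      (hSc.trans (powCentralizer_le_pow c i)).trans
        (by simpa using powCentralizer_inv_le ((c ^ i)⁻¹))
    have hc1 : Commute ((u : G) * c ^ i) ((c ^ i)⁻¹) :=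
      ((huc i).mul_left (Commute.refl _)).inv_right
    have h2 := (le_inf le_rfl h1).trans (powCentralizer_inf_le hc1)
    simpa using h2
  have hSfin : S.FiniteIndex := hfin _ (A.mul_mem u.2 (A.pow_mem hc i))
  have hSeq : S = powCentralizer (u : G) := by
    by_contra hne
    exact absurd (hmax _ hi) (not_le.mpr (by
      simpa [hS] using Subgroup.index_strictAnti (lt_of_le_of_ne hSu hne)))
  exact hSeq ▸ hSc

/-! ### One open normal subgroup for all of `K` -/

/-- If an element with a power having open centralizer is such that every element of the closed
subgroup `N` commutes with one of its powers, then one power centralizes `N`. -/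
theorem exists_pow_mem_centralizer_of_le_powCentralizer [CompactSpace G] {x : G} {n : ℕ}
    (hn : 0 < n) (ho : IsOpen (Subgroup.centralizer {x ^ n} : Set G)) {N : Subgroup G}
    (hN : IsClosed (N : Set G)) (hle : N ≤ powCentralizer x) :
    ∃ k, 0 < k ∧ x ^ k ∈ Subgroup.centralizer (N : Set G) := by
  have hmono : ∀ {a b : ℕ}, a ∣ b →
      Subgroup.centralizer {x ^ a} ≤ Subgroup.centralizer {x ^ b} := by
    rintro a _ ⟨b, rfl⟩ g hg
    rw [Subgroup.mem_centralizer_singleton_iff] at hg ⊢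
    rw [pow_mul]
    exact Commute.pow_right hg b
  -- The factor `n` makes each covering set open; centralizers of powers grow along divisibility, so
  -- the product of the exponents serves all of `N`.
  obtain ⟨t, ht⟩ := hN.isCompact.elim_finite_subcover
    (fun k : ℕ => (Subgroup.centralizer {x ^ (n * (k + 1))} : Set G))
    (fun k => Subgroup.isOpen_mono (hmono (dvd_mul_right _ _)) ho)
    (by
      intro g hg
      obtain ⟨k, hk, hgk⟩ := hle hg
      obtain ⟨k, rfl⟩ := Nat.exists_eq_succ_of_ne_zero hk.ne'
      exact Set.mem_iUnion.mpr ⟨k, hmono (dvd_mul_left _ _)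
        (Subgroup.mem_centralizer_singleton_iff.mpr hgk)⟩)
  refine ⟨n * ∏ k ∈ t, (k + 1), Nat.mul_pos hn (Finset.prod_pos fun k _ => k.succ_pos), ?_⟩
  rw [Subgroup.mem_centralizer_iff]
  intro g hg
  obtain ⟨k, hk, hgk⟩ := Set.mem_iUnion₂.mp (ht hg)
  exact Subgroup.mem_centralizer_singleton_iff.mp
    (hmono (Nat.mul_dvd_mul_left n (Finset.dvd_prod_of_mem (fun k => k + 1) hk)) hgk)

theorem isOpen_normalCore [CompactSpace G] {T : Subgroup G} (hT : IsOpen (T : Set G)) :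
    IsOpen (T.normalCore : Set G) := by
  have := finiteIndex_of_isOpen hT
  exact Subgroup.isOpen_of_isClosed_of_finiteIndex _
    (T.normalCore_isClosed (Subgroup.isClosed_of_isOpen T hT))

/-- If every element of the closed subgroup `K` has a power with open centralizer in `G`, then
one open normal subgroup is centralized by a power of each element of `K`. -/
theorem exists_normal_forall_pow_mem_centralizer [CompactSpace G] [T2Space G] {K : Subgroup G}
    (hK : IsClosed (K : Set G))
    (hpow : ∀ x ∈ K, ∃ n, 0 < n ∧ IsOpen (Subgroup.centralizer {x ^ n} : Set G)) :
    ∃ T : Subgroup G, T.Normal ∧ IsOpen (T : Set G) ∧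
      ∀ x ∈ K, ∃ k, 0 < k ∧ x ^ k ∈ Subgroup.centralizer (T : Set G) := by
  by_contra! hcon
  have hstep : ∀ T : Subgroup G, IsOpen (T : Set G) →
      ∃ x ∈ K, ¬ T ≤ powCentralizer x := by
    intro T hT
    have hN := isOpen_normalCore hT
    obtain ⟨x, hx, hxk⟩ := hcon T.normalCore inferInstance hN
    refine ⟨x, hx, fun hle => ?_⟩
    obtain ⟨n, hn, ho⟩ := hpow x hx
    obtain ⟨k, hk, h⟩ := exists_pow_mem_centralizer_of_le_powCentralizer hn ho
      (Subgroup.isClosed_of_isOpen _ hN) (T.normalCore_le.trans hle)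
    exact hxk k hk h
  obtain ⟨f, hf, hr⟩ := exists_seq_of_forall_finset_exists
    (fun p : G × Subgroup G => p.1 ∈ K ∧ IsOpen (p.2 : Set G) ∧
      p.2 ≤ Subgroup.centralizer {p.1})
    (fun p q => Commute p.1 q.1 ∧ q.2 ≤ p.2 ∧ ¬ p.2 ≤ powCentralizer q.1) (by
      intro s hs
      have hTo : IsOpen ((⨅ p ∈ s, p.2 : Subgroup G) : Set G) := by
        simp only [Subgroup.coe_iInf]
        exact isOpen_biInter_finset fun p hp => (hs p hp).2.1
      set T : Subgroup G := ⨅ p ∈ s, p.2 with hT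
      have hTle : ∀ p ∈ s, T ≤ p.2 := fun p hp => iInf₂_le p hp
      obtain ⟨x, hx, hxT⟩ := hstep T hTo
      obtain ⟨n, hn, ho⟩ := hpow x hx
      -- A power inside `T` commutes with all earlier elements, since `T` centralizes them.
      obtain ⟨k, hk, hkT⟩ := exists_pow_mem_nhds_one (x ^ n) (hTo.mem_nhds T.one_mem) 0
      have hle : Subgroup.centralizer {x ^ n} ≤ Subgroup.centralizer {(x ^ n) ^ k} := by
        intro g hg
        rw [Subgroup.mem_centralizer_singleton_iff] at hg ⊢
        exact Commute.pow_right hg k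
      refine ⟨((x ^ n) ^ k, T ⊓ Subgroup.centralizer {x ^ n}),
        ⟨K.pow_mem (K.pow_mem hx n) k, hTo.inter ho, inf_le_right.trans hle⟩, fun p hp =>
        ⟨?_, inf_le_left.trans (hTle p hp), fun h => hxT ?_⟩⟩
      · have := Subgroup.mem_centralizer_singleton_iff.mp ((hs p hp).2.2 (hTle p hp hkT))
        exact this.symm
      · exact ((hTle p hp).trans h).trans
          ((powCentralizer_pow_le _ hk).trans (powCentralizer_pow_le _ hn)))
  have hcomm : ∀ i j, Commute (f i).1 (f j).1 := by
    intro i j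
    rcases lt_trichotomy i j with h | rfl | h
    · exact (hr i j h).1
    · exact Commute.refl _
    · exact (hr j i h).1.symm
  set B : Subgroup G := Subgroup.closure (Set.range fun i => (f i).1) with hB
  have hBK : B ≤ K := (Subgroup.closure_le _).mpr (by rintro _ ⟨i, rfl⟩; exact (hf i).1)
  have hBcomm : ∀ a ∈ B.topologicalClosure, ∀ b ∈ B.topologicalClosure, Commute a b := by
    have h1 : B ≤ Subgroup.centralizer (Set.range fun i => (f i).1) := by
      refine (Subgroup.closure_le _).mpr ?_
      rintro _ ⟨i, rfl⟩
      rw [SetLike.mem_coe, Subgroup.mem_centralizer_iff]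
      rintro _ ⟨j, rfl⟩
      exact hcomm j i
    have h2 : B.topologicalClosure ≤ Subgroup.centralizer (Set.range fun i => (f i).1) :=
      B.topologicalClosure_minimal h1 (isClosed_centralizer _)
    have h3 : B ≤ Subgroup.centralizer (B.topologicalClosure : Set G) := by
      refine (Subgroup.closure_le _).mpr ?_
      rintro _ ⟨i, rfl⟩
      rw [SetLike.mem_coe, Subgroup.mem_centralizer_iff]
      intro a ha
      exact (Subgroup.mem_centralizer_iff.mp (h2 ha) _ ⟨i, rfl⟩).symm
    have h4 := B.topologicalClosure_minimal h3 (isClosed_centralizer _)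
    intro a ha b hb
    exact Subgroup.mem_centralizer_iff.mp (h4 hb) a ha
  obtain ⟨u, -, hufin, hu⟩ := exists_powCentralizer_le B.isClosed_topologicalClosure hBcomm
    (fun a ha => hpow a (B.topologicalClosure_minimal hBK hK ha))
  obtain ⟨i, -, j, -, hij, he⟩ := (Set.infinite_univ (α := ℕ)).exists_lt_map_eq_of_mapsTo
    (f := fun i => ⨅ l ∈ Set.Iic i, powCentralizer (f l).1)
    (t := {S | powCentralizer u ≤ S})
    (fun i _ => le_iInf₂ fun l _ => hu _
      (B.le_topologicalClosure (Subgroup.subset_closure ⟨l, rfl⟩)))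
    (finite_setOf_le_of_finiteIndex _)
  refine (hr i j hij).2.2 ?_
  have h1 : (f i).2 ≤ ⨅ l ∈ Set.Iic i, powCentralizer (f l).1 := by
    refine le_iInf₂ fun l hl => ?_
    have h2 : (f i).2 ≤ (f l).2 := by
      rcases (Set.mem_Iic.mp hl).lt_or_eq with h | rfl
      · exact (hr l i h).2.1
      · exact le_rfl
    refine (h2.trans (hf l).2.2).trans ?_
    simpa using centralizer_pow_le_powCentralizer (f l).1 one_pos
  exact (h1.trans he.le).trans (iInf₂_le j (Set.mem_Iic.mpr le_rfl))

/-! ### Torsion quotients and the two equivalences -/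

theorem isMulTorsion_quotient_iff {G : Type*} [Group G] (N : Subgroup G) [N.Normal] :
    IsMulTorsion (G ⧸ N) ↔ ∀ x : G, ∃ k, 0 < k ∧ x ^ k ∈ N := by
  constructor
  · intro h x
    obtain ⟨k, hk, h⟩ := isOfFinOrder_iff_pow_eq_one.mp (h x)
    exact ⟨k, hk, by rwa [← QuotientGroup.mk_pow, QuotientGroup.eq_one_iff] at h⟩
  · intro h q
    obtain ⟨x, rfl⟩ := QuotientGroup.mk_surjective q
    obtain ⟨k, hk, h⟩ := h x
    exact isOfFinOrder_iff_pow_eq_one.mpr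
      ⟨k, hk, by rwa [← QuotientGroup.mk_pow, QuotientGroup.eq_one_iff]⟩

theorem isMulTorsion_quotient_centralizerIn_iff {G : Type*} [Group G] (K T : Subgroup G)
    [T.Normal] : IsMulTorsion (K ⧸ centralizerIn K T) ↔
      ∀ x ∈ K, ∃ k, 0 < k ∧ x ^ k ∈ Subgroup.centralizer (T : Set G) := by
  rw [isMulTorsion_quotient_iff]
  simp [centralizerIn, Subgroup.mem_subgroupOf]

theorem mem_centerOf_iff {G : Type*} [Group G] (T : Subgroup G) {x : G} :
    x ∈ centerOf T ↔ x ∈ T ∧ x ∈ Subgroup.centralizer (T : Set G) := by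
  simp only [centerOf, Subgroup.mem_map, Subgroup.mem_center_iff, Subgroup.mem_centralizer_iff]
  constructor
  · rintro ⟨y, hy, rfl⟩
    exact ⟨y.2, fun g hg => congrArg Subtype.val (hy ⟨g, hg⟩)⟩
  · rintro ⟨hx, h⟩
    exact ⟨⟨x, hx⟩, fun g => Subtype.ext (h g g.2), rfl⟩

theorem forall_commutingPr_pos_iff [CompactSpace G] [T2Space G] {K : Subgroup G}
    (hK : IsClosed (K : Set G)) :
    (∀ x ∈ K, 0 < commutingPr (monothetic x)) ↔
      ∃ (T : Subgroup G) (_ : T.Normal), IsOpen (T : Set G) ∧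
        IsMulTorsion (K ⧸ centralizerIn K T) := by
  constructor
  · intro h
    obtain ⟨T, hT, ho, hk⟩ := exists_normal_forall_pow_mem_centralizer hK
      fun x hx => exists_isOpen_centralizer_pow (h x hx)
    exact ⟨T, hT, ho, (isMulTorsion_quotient_centralizerIn_iff K T).mpr hk⟩
  · rintro ⟨T, hT, ho, ht⟩ x hx
    obtain ⟨k, hk, hxk⟩ := (isMulTorsion_quotient_centralizerIn_iff K T).mp ht x hx
    refine commutingPr_monothetic_pos hk (Subgroup.isOpen_mono (H₁ := T) ?_ ho)
    intro g hg
    exact Subgroup.mem_centralizer_singleton_iff.mpr (Subgroup.mem_centralizer_iff.mp hxk g hg)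

theorem isVirtuallyCentralByTorsion_iff [CompactSpace G] :
    IsVirtuallyCentralByTorsion G ↔ ∃ (T : Subgroup G) (_ : T.Normal), IsOpen (T : Set G) ∧
      IsMulTorsion ((⊤ : Subgroup G) ⧸ centralizerIn ⊤ T) := by
  refine exists_congr fun T => exists_congr fun hT => and_congr_right fun ho => ?_
  rw [isMulTorsion_quotient_centralizerIn_iff, isMulTorsion_quotient_iff]
  simp only [mem_centerOf_iff, Subgroup.mem_top, forall_const]
  refine forall_congr' fun x => ⟨fun ⟨k, hk, h⟩ => ⟨k, hk, h.2⟩, fun ⟨k, hk, h⟩ => ?_⟩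
  -- A further power lands in the open `T`, turning an element of the centralizer into one of
  -- `Z(T)`.
  obtain ⟨l, hl, hlT⟩ := exists_pow_mem_nhds_one (x ^ k) (ho.mem_nhds T.one_mem) 0
  refine ⟨k * l, Nat.mul_pos hk hl, ?_⟩
  rw [pow_mul]
  exact ⟨hlT, pow_mem h l⟩

end CompactGroupPr

theorem theorem1p1 (G : Type*) [Group G] [TopologicalSpace G] [IsTopologicalGroup G]
    [CompactSpace G] [T2Space G] :
    (∀ K : Subgroup G, IsClosed (K : Set G) →
      ((∀ x ∈ K, 0 < CompactGroupPr.commutingPr (CompactGroupPr.monothetic x)) ↔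
        ∃ (T : Subgroup G) (_ : T.Normal), IsOpen (T : Set G) ∧
          IsMulTorsion (K ⧸ CompactGroupPr.centralizerIn K T))) ∧
    ((∀ x : G, 0 < CompactGroupPr.commutingPr (CompactGroupPr.monothetic x)) ↔
      CompactGroupPr.IsVirtuallyCentralByTorsion G) := by
  refine ⟨fun K hK => CompactGroupPr.forall_commutingPr_pos_iff hK, ?_⟩
  rw [CompactGroupPr.isVirtuallyCentralByTorsion_iff,
    ← CompactGroupPr.forall_commutingPr_pos_iff (K := ⊤) isClosed_univ]
  simp
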